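/- **Setting.** Let $r:\mathbb R^n\to\mathbb R^p$ and $c:\mathbb R^n\to\mathbb R^m$ be continuously differentiable with Jacobians $J^r,J^c$. For $\gamma>0$ and an orthogonal matrix $U=[u_1,\dots,u_n]$, the approximate gradient of a real function $f$ is $\nabla f_s(x)=\sum_{j=1}^n\frac{f(x+\gamma u_j)-f(x)}{\gamma}u_j$, and the approximate Jacobians $J^r_s(x)$, $J^c_s(x)$ have the rows $\nabla r_{s,i}(x)^T$, $\nabla c_{s,i}(x)^T$. Norms are Euclidean (for matrices: the induced operator norm). For $x,z,y$ and approximate Jacobians $J^r_s,J^c_s$ write $$\|F_s\|_*=\|(J^r_s)^Tz-(J^c_s)^Ty\|+\|z-r(x)\|+\|c(x)\|,\qquad \nabla_xL_s(x,y)=(J^r_s)^Tr(x)-(J^c_s)^Ty .$$ Fix an outer index $k$ and the outer data: $w_k=(x_k,z_k,y_k)$, $\gamma_k,\delta_k,\epsilon_k>0$, $\theta\in(0,1)$, the approximate Jacobians $J^r_{s_k},J^c_{s_k}$ at $x_k$ (built with $\gamma_k$ and an orthogonal matrix), and $0<p_0<p_1<1<p_2$, $0<p_3<1<p_4$, $0<\lambda_{\min}<\lambda_{k,0}$.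 Put $$\nabla\phi_{k,s}(x;\delta)=(J^r_s)^Tr(x)-(J^c_s)^Ty_k+\delta^{-1}(J^c_s)^Tc(x),\quad \Phi_k(x;\delta)=\begin{bmatrix}r(x)\\ \delta^{-1/2}(c(x)-\delta y_k)\end{bmatrix},\quad J^\Phi_s=\begin{bmatrix}J^r_s\\ \delta^{-1/2}J^c_s\end{bmatrix}.$$ **Inner procedure.** Start with $w_{k,0}=w_k$, $J^{r}_{s_{k,0}}=J^r_{s_k}$, $J^{c}_{s_{k,0}}=J^c_{s_k}$, $\gamma_{k,0}=\gamma_k$, $\delta_{k,0}=\delta_{k,-1}=\delta_k$, and assume $\nabla\phi_{k,s_k}(x_k;\delta_k)\neq0$ (so that the first step is nonzero and all smoothing parameters are positive). Iteration $j$, with $J=J^\Phi_s$ and $g=\nabla\phi_{k,s}(x_{k,j};\delta_{k,j})$ formed from $J^r_{s_{k,j}},J^c_{s_{k,j}},\delta_{k,j}$: 1. $d$ solves $(J^TJ+\lambda_{k,j}\|g\|I)d=-g$ ($d=0$ if $g=0$). 2. $\zeta=\dfrac{\|\Phi_k(x_{k,j};\delta_{k,j})\|^2-\|\Phi_k(x_{k,j}+d;\delta_{k,j})\|^2}{\|\Phi_k(x_{k,j};\delta_{k,j})\|^2-\|\Phi_k(x_{k,j};\delta_{k,j})+Jd\|^2}$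 (a step with $0/0$ counts as $\zeta<p_0$). 3. $x_{k,j+1}=x_{k,j}+d$ if $\zeta\ge p_0$, and $x_{k,j+1}=x_{k,j}$ otherwise. 4. $\lambda_{k,j+1}=4\lambda_{k,j}$ if $\zeta<p_0$ or $\|J^T\Phi_k(x_{k,j};\delta_{k,j})\|<p_1/\lambda_{k,j}$; otherwise $\lambda_{k,j+1}=\lambda_{k,j}$ if $\|J^T\Phi_k(x_{k,j};\delta_{k,j})\|<p_2/\lambda_{k,j}$, and $\max\{\tfrac14\lambda_{k,j},\lambda_{\min}\}$ if not. 5. $z_{k,j+1}=r(x_{k,j+1})$. 6. If $\delta_{k,j}=\delta_{k,j-1}$, then $\gamma_{k,j+1}=\min\{\frac12\gamma_{k,j},\|d\|\}$. Otherwise $\gamma_{k,j+1}$ is $\frac12\gamma_{k,j}$, $\gamma_{k,j}$ or $\min\{2\gamma_{k,j},\gamma_k\}$ according as $\|(J^c_{s_{k,j}})^Tc(x_{k,j})\|$ is in $[0,p_3\gamma_{k,j})$, in $[p_3\gamma_{k,j},p_4\gamma_{k,j})$, or $\ge p_4\gamma_{k,j}$. 7. Compute $J^r_{s_{k,j+1}},J^c_{s_{k,j+1}}$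 at $x_{k,j+1}$ with $\gamma_{k,j+1}$ and a new random orthogonal matrix, uniform (Haar) on $\{U:U^TU=I\}$ and independent of the earlier ones. 8. If $\|\nabla_xL_{s_{k,j+1}}(x_{k,j+1},y_k-\delta_{k,j}^{-1}c(x_{k,j+1}))\|\le\theta\|\nabla_xL_{s_k}(x_k,y_k)\|+\frac12\epsilon_k$ and $\|c(x_{k,j+1})\|>\theta\|c(x_k)\|+\frac12\epsilon_k$, then $\delta_{k,j+1}=\frac1{10}\delta_{k,j}$; otherwise $\delta_{k,j+1}=\delta_{k,j}$. Put $y_{k,j+1}=y_k-\delta_{k,j+1}^{-1}c(x_{k,j+1})$. 9. If $\|F_{s_{k,j+1}}\|_*\le\theta\|F_{s_k}\|_*+\epsilon_k$, where $\|F_{s_{k,j+1}}\|_*$ is formed from $w_{k,j+1}$ and $J^r_{s_{k,j+1}},J^c_{s_{k,j+1}}$, the procedure returns, and all its quantities keep their values for larger indices; otherwise it goes on with $j+1$. Capital letters denote the random quantities. **Theorem.** Assume that $J^r$, $J^c$, $r$ and $c$ are Lipschitz continuous on $\mathbb R^n$ and that in every realization of the inner procedure the sequences $J^r_{s_{k,j}}$,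 $J^c_{s_{k,j}}$, $r(x_{k,j})$, $c(x_{k,j})$, $j\ge0$, are bounded. Let $\mathcal E_1$ be the event that $\Delta_{k,j}$ (the random $\delta_{k,j}$) decreases only finitely many times, and $\mathcal E_2$ its complement. Then: (i) if $\mathbb P(\mathcal E_1)>0$, then for every $0<q<1$ there is a $j$ such that $$\mathbb P\bigl(\|F_{S_{k,j+1}}\|_*\le\theta\|F_{s_k}\|_*+\epsilon_k\ \big|\ \mathcal E_1\bigr)\ge q;$$ (ii) almost surely on $\mathcal E_2$, $$\liminf_{j\to\infty}\|J^c(X_{k,j})^Tc(X_{k,j})\|=0 .$$ -/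

import Mathlib

open MeasureTheory ProbabilityTheory Filter
open scoped Matrix Matrix.Norms.L2Operator ENNReal

noncomputable section

namespace DFLM

/-- `ℝⁿ` with the Euclidean norm. -/
abbrev Vec (n : ℕ) := EuclideanSpace ℝ (Fin n)

/-- Matrix-vector product on Euclidean spaces. -/
def act {ι κ : Type*} [Fintype κ] (A : Matrix ι κ ℝ) (v : EuclideanSpace ℝ κ) :
    EuclideanSpace ℝ ι :=
  WithLp.toLp 2 (A *ᵥ v.ofLp)

/-- The exact Jacobian matrix `J^f(x)`, with entries `∂ f_i / ∂ x_l`. -/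
def jac {n q : ℕ} (f : Vec n → Vec q) (x : Vec n) : Matrix (Fin q) (Fin n) ℝ :=
  Matrix.of fun i l => (fderiv ℝ f x (EuclideanSpace.single l 1)) i

/-- The Stiefel manifold `St(n) = {U ∈ ℝ^{n×n} : Uᵀ U = I}`. -/
abbrev St (n : ℕ) := Matrix.orthogonalGroup (Fin n) ℝ

/-- `St(n) = O(n)` carries its Borel σ-algebra. -/
instance instMeasurableSpaceSt (n : ℕ) : MeasurableSpace (St n) := borel (St n)

instance instBorelSpaceSt (n : ℕ) : BorelSpace (St n) := ⟨rfl⟩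

/-- The `j`-th column `u_j` of `U = [u_1, …, u_n]`. -/
def column {n : ℕ} (U : St n) (j : Fin n) : Vec n :=
  WithLp.toLp 2 fun i => (U : Matrix (Fin n) (Fin n) ℝ) i j

/-- Gradient approximation of a real function along the orthonormal directions `u_1, …, u_n`:
`∇f_s(x) = ∑_j ((f (x + γ u_j) - f x) / γ) u_j`. -/
def approxGrad {n : ℕ} (f : Vec n → ℝ) (γ : ℝ) (U : St n) (x : Vec n) : Vec n :=
  ∑ j, ((f (x + γ • column U j) - f x) / γ) • column U j

/-- The approximate Jacobian `J^f_s(x)`, whose `i`-th row is `∇f_{s,i}(x)ᵀ`. -/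
def approxJac {n q : ℕ} (f : Vec n → Vec q) (γ : ℝ) (U : St n) (x : Vec n) :
    Matrix (Fin q) (Fin n) ℝ :=
  Matrix.of fun i => (approxGrad (fun v => f v i) γ U x).ofLp

/-- `U` is uniformly distributed on the Stiefel manifold: it is a random variable whose law is the
Haar probability measure of `O(n)`, i.e. the (unique) probability measure on `O(n)` that is
invariant under left multiplication by orthogonal matrices. -/
structure IsUniformStiefel {n : ℕ} {Ω : Type*} [MeasurableSpace Ω] (P : Measure Ω)
    (U : Ω → St n) : Prop where
  measurable : Measurable U
  invariant : (P.map U).IsMulLeftInvariant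

/-- Everything that is fixed when the inner procedure is called at an outer iteration `k`:
the problem functions, the outer iterate `w_k = (x_k, z_k, y_k)`, the orthogonal directions from
which `J^r_{s_k}`, `J^c_{s_k}` were computed, and all parameters. -/
structure Input (n p m : ℕ) where
  r : Vec n → Vec p
  c : Vec n → Vec m
  /-- `x_k` -/
  xk : Vec n
  /-- `z_k` -/
  zk : Vec p
  /-- `y_k` -/
  yk : Vec m
  /-- the directions used for `J^r_{s_k}` and `J^c_{s_k}` -/
  Uk : St n
  /-- `γ_k` -/
  γk : ℝ
  /-- `δ_k` -/
  δk : ℝ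
  /-- `ε_k` -/
  εk : ℝ
  θ : ℝ
  p0 : ℝ
  p1 : ℝ
  p2 : ℝ
  p3 : ℝ
  p4 : ℝ
  lamMin : ℝ
  /-- `λ_{k,0}` -/
  lam0 : ℝ

/-- The variables of the inner procedure at inner iteration `j`. -/
structure State (n p m : ℕ) where
  /-- `x_{k,j}` -/
  x : Vec n
  /-- `z_{k,j}` -/
  z : Vec p
  /-- `y_{k,j}` -/
  y : Vec m
  /-- `J^r_{s_{k,j}}` -/
  Jr : Matrix (Fin p) (Fin n) ℝ
  /-- `J^c_{s_{k,j}}` -/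
  Jc : Matrix (Fin m) (Fin n) ℝ
  /-- `λ_{k,j}` -/
  lam : ℝ
  /-- `γ_{k,j}` -/
  γ : ℝ
  /-- `δ_{k,j}` -/
  δ : ℝ
  /-- `δ_{k,j-1}` -/
  δprev : ℝ

/-- `J^Φ_s(x; δ)`, obtained by stacking `J^r_s` and `δ^{-1/2} J^c_s`. -/
def State.JPhi {n p m : ℕ} (s : State n p m) : Matrix (Fin p ⊕ Fin m) (Fin n) ℝ :=
  Matrix.fromRows s.Jr ((Real.sqrt s.δ)⁻¹ • s.Jc)

namespace Input

variable {n p m : ℕ} (D : Input n p m)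

/-- `J^r_{s_k}`. -/
def Jrk : Matrix (Fin p) (Fin n) ℝ := approxJac D.r D.γk D.Uk D.xk

/-- `J^c_{s_k}`. -/
def Jck : Matrix (Fin m) (Fin n) ℝ := approxJac D.c D.γk D.Uk D.xk

/-- Approximate gradient in `x` of the Lagrangian `½‖r(x)‖² - yᵀ c(x)`:
`∇ₓL_s(x, y) = (J^r_s)ᵀ r(x) - (J^c_s)ᵀ y`. -/
def gradL (Jr : Matrix (Fin p) (Fin n) ℝ) (Jc : Matrix (Fin m) (Fin n) ℝ)
    (x : Vec n) (y : Vec m) : Vec n :=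
  act Jrᵀ (D.r x) - act Jcᵀ y

/-- Approximate gradient of the augmented Lagrangian `φ_k(·; δ)`:
`∇φ_{k,s}(x; δ) = (J^r_s)ᵀ r(x) - (J^c_s)ᵀ y_k + δ⁻¹ (J^c_s)ᵀ c(x)`. -/
def gradPhi (Jr : Matrix (Fin p) (Fin n) ℝ) (Jc : Matrix (Fin m) (Fin n) ℝ)
    (x : Vec n) (δ : ℝ) : Vec n :=
  act Jrᵀ (D.r x) - act Jcᵀ D.yk + δ⁻¹ • act Jcᵀ (D.c x)

/-- The least squares residual `Φ_k(x; δ) = (r(x), δ^{-1/2} (c(x) - δ y_k))`. -/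
def bigPhi (x : Vec n) (δ : ℝ) : EuclideanSpace ℝ (Fin p ⊕ Fin m) :=
  WithLp.toLp 2 (Sum.elim (D.r x).ofLp ((Real.sqrt δ)⁻¹ • (D.c x - δ • D.yk)).ofLp)

/-- The merit function
`‖F_s‖_* = ‖(J^r_s)ᵀ z - (J^c_s)ᵀ y‖ + ‖z - r(x)‖ + ‖c(x)‖`. -/
def merit (x : Vec n) (z : Vec p) (y : Vec m)
    (Jr : Matrix (Fin p) (Fin n) ℝ) (Jc : Matrix (Fin m) (Fin n) ℝ) : ℝ :=
  ‖act Jrᵀ z - act Jcᵀ y‖ + ‖z - D.r x‖ + ‖D.c x‖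

/-- `‖F_{s_k}‖_*`. -/
def meritk : ℝ := D.merit D.xk D.zk D.yk D.Jrk D.Jck

/-- `‖F_{s_{k,j}}(w_{k,j})‖_*`. -/
def meritState (s : State n p m) : ℝ := D.merit s.x s.z s.y s.Jr s.Jc

/-- The sufficient decrease condition `‖F_{s_{k,j}}‖_* ≤ θ ‖F_{s_k}‖_* + ε_k`. -/
def SufficientDecrease (s : State n p m) : Prop :=
  D.meritState s ≤ D.θ * D.meritk + D.εk

/-- `∇φ_{s_{k,j}}`. -/
def grad (s : State n p m) : Vec n := D.gradPhi s.Jr s.Jc s.x s.δ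

/-- The Levenberg-Marquardt step: the solution `d` of
`(Jᵀ J + λ ‖∇φ_s‖ I) d = -∇φ_s`, where `J = J^Φ_s`.  For `λ > 0` the matrix is positive definite
unless `∇φ_s = 0`; in that case `d = 0`. -/
def lmStep (s : State n p m) : Vec n :=
  act ((s.JPhi)ᵀ * s.JPhi + (s.lam * ‖D.grad s‖) • (1 : Matrix (Fin n) (Fin n) ℝ))⁻¹
    (-D.grad s)

/-- The ratio `ζ_{k,j}` of actual to predicted reduction. -/
def ratio (s : State n p m) : ℝ :=
  (‖D.bigPhi s.x s.δ‖ ^ 2 - ‖D.bigPhi (s.x + D.lmStep s) s.δ‖ ^ 2) /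
    (‖D.bigPhi s.x s.δ‖ ^ 2 - ‖D.bigPhi s.x s.δ + act s.JPhi (D.lmStep s)‖ ^ 2)

/-- `x_{k,j+1}`. -/
def nextX (s : State n p m) : Vec n :=
  if D.p0 ≤ D.ratio s then s.x + D.lmStep s else s.x

/-- `λ_{k,j+1}`. -/
def nextLam (s : State n p m) : ℝ :=
  if D.ratio s < D.p0 then 4 * s.lam
  else if ‖act (s.JPhi)ᵀ (D.bigPhi s.x s.δ)‖ < D.p1 / s.lam then 4 * s.lam
  else if ‖act (s.JPhi)ᵀ (D.bigPhi s.x s.δ)‖ < D.p2 / s.lam then s.lam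
  else max (0.25 * s.lam) D.lamMin

/-- `γ_{k,j+1}`. -/
def nextγ (s : State n p m) : ℝ :=
  if s.δ = s.δprev then min (1 / 2 * s.γ) ‖D.lmStep s‖
  else if ‖act s.Jcᵀ (D.c s.x)‖ < D.p3 * s.γ then 1 / 2 * s.γ
  else if ‖act s.Jcᵀ (D.c s.x)‖ < D.p4 * s.γ then s.γ
  else min (2 * s.γ) D.γk

/-- `J^r_{s_{k,j+1}}`, computed at `x_{k,j+1}` with `γ_{k,j+1}` and new directions `U`. -/
def nextJr (s : State n p m) (U : St n) : Matrix (Fin p) (Fin n) ℝ :=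
  approxJac D.r (D.nextγ s) U (D.nextX s)

/-- `J^c_{s_{k,j+1}}`, computed with the same directions. -/
def nextJc (s : State n p m) (U : St n) : Matrix (Fin m) (Fin n) ℝ :=
  approxJac D.c (D.nextγ s) U (D.nextX s)

/-- `δ_{k,j+1}`. -/
def nextδ (s : State n p m) (U : St n) : ℝ :=
  if ‖D.gradL (D.nextJr s U) (D.nextJc s U) (D.nextX s)
        (D.yk - s.δ⁻¹ • D.c (D.nextX s))‖
        ≤ D.θ * ‖D.gradL D.Jrk D.Jck D.xk D.yk‖ + 1 / 2 * D.εk ∧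
      D.θ * ‖D.c D.xk‖ + 1 / 2 * D.εk < ‖D.c (D.nextX s)‖
  then 1 / 10 * s.δ else s.δ

/-- One inner iteration, using the newly sampled directions `U`. -/
def step (s : State n p m) (U : St n) : State n p m where
  x := D.nextX s
  z := D.r (D.nextX s)
  y := D.yk - (D.nextδ s U)⁻¹ • D.c (D.nextX s)
  Jr := D.nextJr s U
  Jc := D.nextJc s U
  lam := D.nextLam s
  γ := D.nextγ s
  δ := D.nextδ s U
  δprev := s.δ

/-- The initial state: `w_{k,0} = w_k`, `δ_{k,0} = δ_{k,-1} = δ_k`, `γ_{k,0} = γ_k`, … -/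
def init : State n p m where
  x := D.xk
  z := D.zk
  y := D.yk
  Jr := D.Jrk
  Jc := D.Jck
  lam := D.lam0
  γ := D.γk
  δ := D.δk
  δprev := D.δk

open Classical in
/-- The run of the inner procedure driven by the sampled directions `U 0, U 1, …`, where `U j` is
used for the Jacobians of index `j + 1`.  After each iteration the sufficient decrease condition is
tested; as soon as it holds the procedure returns, and the returned state is kept from then on. -/
def run (U : ℕ → St n) : ℕ → State n p m
  | 0 => D.init
  | j + 1 =>
    if j ≠ 0 ∧ D.SufficientDecrease (run U j) then run U j else D.step (run U j) (U j)

/-- The event that the penalty parameter `δ_{k,j}` decreases only finitely many times. -/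
def finiteDecrease {Ω : Type*} (U : ℕ → Ω → St n) : Set Ω :=
  {ω | {j : ℕ | (D.run (fun i => U i ω) (j + 1)).δ < (D.run (fun i => U i ω) j).δ}.Finite}

/-- The requirements on the input of the inner procedure. The last one says that the first LM step
is nonzero, without which `γ_{k,1} = 0` and the next Jacobian approximations are undefined. -/
structure Valid : Prop where
  γk_pos : 0 < D.γk
  δk_pos : 0 < D.δk
  εk_pos : 0 < D.εk
  θ_pos : 0 < D.θ
  θ_lt : D.θ < 1
  p0_pos : 0 < D.p0
  p0_lt : D.p0 < D.p1
  p1_lt : D.p1 < 1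
  p2_gt : 1 < D.p2
  p3_pos : 0 < D.p3
  p3_lt : D.p3 < 1
  p4_gt : 1 < D.p4
  lamMin_pos : 0 < D.lamMin
  lamMin_lt : D.lamMin < D.lam0
  grad_ne_zero : D.gradPhi D.Jrk D.Jck D.xk D.δk ≠ 0

end Input

end DFLM

end

/-! Both claims hold path by path. Fix a realization in which the procedure never returns.

Suppose `δ` is eventually constant. The multiplier `y_k - δ⁻¹ c` turns the Lagrangian gradient of
the penalty test into `∇φ_s`. If `‖∇φ_s‖ ≤ ε_k/2`, then either `c` is large and `δ` drops, or `c` is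
small and sufficient decrease holds (`sufficientDecrease_step`); hence eventually `‖∇φ_s‖ > ε_k/2`.
Meanwhile `γ` is halved at each iteration and the Jacobian errors, of order `γ`, vanish. Since `‖d‖
≤ 1/λ`, the linear model of `Φ_k` is then accurate for large `λ`: such steps are accepted and do not
raise `λ`, so `λ` stays bounded. A bounded `λ` and a gradient bounded below make every predicted
reduction exceed a fixed constant. As `‖Φ_k‖² ≥ 0`, only finitely many steps are accepted, and the
remaining rejections drive `λ` to infinity, a contradiction (`false_of_eventually_const`). So every
path in `E₁` returns; returned states are frozen, the return events increase and cover `E₁`, and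
continuity from below gives (i).

Suppose `δ` drops infinitely often. Then `δ → 0`, and at each drop the bound on `∇φ_s`, multiplied
by `δ`, gives `‖(J^c_s)ᵀ c‖ = O(δ)` (`norm_act_Jc_transpose_le`). The same bound forces `γ → 0`, so
the exact `‖(J^c)ᵀ c‖` tends to zero along the drops. This is (ii). -/

namespace DFLM

/-! ### Matrices acting on Euclidean spaces -/

section Act

variable {ι κ : Type*} [Fintype κ]

theorem act_sub (A : Matrix ι κ ℝ) (v w : EuclideanSpace ℝ κ) :
    act A (v - w) = act A v - act A w := by
  ext i; simp [act, Matrix.mulVec_sub]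

theorem act_smul (A : Matrix ι κ ℝ) (a : ℝ) (v : EuclideanSpace ℝ κ) :
    act A (a • v) = a • act A v := by
  ext i; simp [act, Matrix.mulVec_smul]

theorem sub_act (A B : Matrix ι κ ℝ) (v : EuclideanSpace ℝ κ) :
    act (A - B) v = act A v - act B v := by
  ext i; simp [act, Matrix.sub_mulVec]

variable [Fintype ι]

theorem inner_act_transpose (A : Matrix ι κ ℝ) (w : EuclideanSpace ℝ ι)
    (v : EuclideanSpace ℝ κ) : inner ℝ (act Aᵀ w) v = inner ℝ w (act A v) := by
  simp only [act, EuclideanSpace.inner_eq_star_dotProduct, star_trivial]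
  rw [Matrix.mulVec_transpose, dotProduct_comm, ← Matrix.dotProduct_mulVec, dotProduct_comm]

theorem norm_act_le [DecidableEq κ] (A : Matrix ι κ ℝ) (v : EuclideanSpace ℝ κ) :
    ‖act A v‖ ≤ ‖A‖ * ‖v‖ :=
  Matrix.l2_opNorm_mulVec A v

theorem norm_le_of_norm_act_le [DecidableEq κ] (A : Matrix ι κ ℝ) {C : ℝ} (hC : 0 ≤ C)
    (h : ∀ v, ‖act A v‖ ≤ C * ‖v‖) : ‖A‖ ≤ C := by
  rw [Matrix.l2_opNorm_def]
  exact ContinuousLinearMap.opNorm_le_bound _ hC h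

theorem norm_transpose_eq [DecidableEq ι] [DecidableEq κ] (A : Matrix ι κ ℝ) : ‖Aᵀ‖ = ‖A‖ := by
  rw [← Matrix.l2_opNorm_conjTranspose A, Matrix.conjTranspose_eq_transpose_of_trivial]

end Act

/-! ### Finite-difference Jacobians and their error -/

section Jacobian

variable {n q : ℕ}

theorem act_jac (f : Vec n → Vec q) (x v : Vec n) : act (jac f x) v = fderiv ℝ f x v := by
  have hv : v = ∑ l, v l • EuclideanSpace.single l (1 : ℝ) := by
    ext i; simp [Pi.single_apply]
  conv_rhs => rw [hv]
  ext i
  simp [act, jac, Matrix.mulVec, dotProduct, mul_comm]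

theorem norm_fderiv_sub_le (f : Vec n → Vec q) (x y : Vec n) :
    ‖fderiv ℝ f x - fderiv ℝ f y‖ ≤ ‖jac f x - jac f y‖ := by
  refine ContinuousLinearMap.opNorm_le_bound _ (norm_nonneg _) fun v => ?_
  have := norm_act_le (jac f x - jac f y) v
  rwa [sub_act, act_jac, act_jac] at this

/-- Mean value inequality on the ball of radius `‖v‖` about `x`, where the derivative differs from
the one at `x` by at most `κ‖v‖`. -/
theorem norm_taylor_remainder_le {f : Vec n → Vec q} (hf : ContDiff ℝ 1 f) {κ : ℝ} (hκ : 0 ≤ κ)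
    (hl : ∀ x y, ‖jac f x - jac f y‖ ≤ κ * ‖x - y‖) (x v : Vec n) :
    ‖f (x + v) - f x - act (jac f x) v‖ ≤ κ * ‖v‖ ^ 2 := by
  have hd : Differentiable ℝ f := hf.differentiable (by norm_num)
  have h := Convex.norm_image_sub_le_of_norm_fderiv_le' (𝕜 := ℝ) (f := f) (φ := fderiv ℝ f x)
    (C := κ * ‖v‖) (s := Metric.closedBall x ‖v‖) (x := x) (y := x + v) (fun y _ => hd y)
    (fun y hy => (norm_fderiv_sub_le f y x).trans ((hl y x).trans
      (mul_le_mul_of_nonneg_left (by simpa [dist_eq_norm] using hy) hκ)))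
    (convex_closedBall _ _) (by simp) (by simp)
  rw [act_jac]
  simpa [pow_two, mul_assoc] using h

theorem norm_column (U : St n) (j : Fin n) : ‖column U j‖ = 1 := by
  have h : ((U : Matrix (Fin n) (Fin n) ℝ)ᵀ * (U : Matrix (Fin n) (Fin n) ℝ)) j j = 1 := by
    have := (Matrix.mem_orthogonalGroup_iff' _ _).1 U.2
    rw [this, Matrix.one_apply_eq]
  rw [EuclideanSpace.norm_eq, Real.sqrt_eq_one, ← h]
  simp [column, Matrix.mul_apply, pow_two]

theorem sum_inner_column_smul (U : St n) (v : Vec n) :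
    ∑ j, inner ℝ (column U j) v • column U j = v := by
  have h : (U : Matrix (Fin n) (Fin n) ℝ) *ᵥ ((U : Matrix (Fin n) (Fin n) ℝ)ᵀ *ᵥ v.ofLp)
      = v.ofLp := by
    have := (Matrix.mem_orthogonalGroup_iff _ _).1 U.2
    rw [Matrix.mulVec_mulVec, this, Matrix.one_mulVec]
  ext i
  rw [← congrFun h i]
  simp [column, Matrix.mulVec, dotProduct, PiLp.inner_apply, mul_comm]

theorem act_approxJac (f : Vec n → Vec q) (γ : ℝ) (U : St n) (x v : Vec n) :
    act (approxJac f γ U x) v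
      = ∑ j, inner ℝ (column U j) v • γ⁻¹ • (f (x + γ • column U j) - f x) := by
  ext i
  simp only [act, approxJac, approxGrad, Matrix.mulVec, dotProduct, PiLp.inner_apply,
    WithLp.ofLp_sum, Finset.sum_apply, Matrix.of_apply, WithLp.ofLp_smul,
    Pi.smul_apply, smul_eq_mul, Finset.sum_mul, PiLp.sub_apply, RCLike.inner_apply, conj_trivial]
  rw [Finset.sum_comm]
  refine Finset.sum_congr rfl fun j _ => Finset.sum_congr rfl fun l _ => ?_
  ring

/-- In the basis `u_j` the difference of the two Jacobians is a sum of `n` Taylor remainders divided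
by `γ`, each at most `κγ‖v‖`. -/
theorem norm_approxJac_sub_jac_le {f : Vec n → Vec q} (hf : ContDiff ℝ 1 f) {κ : ℝ} (hκ : 0 ≤ κ)
    (hl : ∀ x y, ‖jac f x - jac f y‖ ≤ κ * ‖x - y‖) {γ : ℝ} (hγ : 0 < γ) (U : St n) (x : Vec n) :
    ‖approxJac f γ U x - jac f x‖ ≤ n * κ * γ := by
  refine norm_le_of_norm_act_le _ (by positivity) fun v => ?_
  have hsum : act (approxJac f γ U x - jac f x) v = ∑ j, inner ℝ (column U j) v •
      γ⁻¹ • (f (x + γ • column U j) - f x - act (jac f x) (γ • column U j)) := by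
    rw [sub_act, act_approxJac]
    -- The first rewrite expands every `v`; the last one restores `v` inside the coefficients.
    conv_lhs => rw [act_jac, ← sum_inner_column_smul U v, map_sum, sum_inner_column_smul U v]
    rw [← Finset.sum_sub_distrib]
    refine Finset.sum_congr rfl fun j _ => ?_
    rw [map_smul, ← smul_sub, act_smul, act_jac, smul_sub γ⁻¹ (_ - _) (γ • _), smul_smul γ⁻¹ γ,
      inv_mul_cancel₀ hγ.ne', one_smul]
  rw [hsum]
  refine (norm_sum_le _ _).trans ?_
  have hterm : ∀ j ∈ Finset.univ, ‖inner ℝ (column U j) v •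
      γ⁻¹ • (f (x + γ • column U j) - f x - act (jac f x) (γ • column U j))‖ ≤ κ * γ * ‖v‖ := by
    intro j _
    have h1 := norm_taylor_remainder_le hf hκ hl x (γ • column U j)
    rw [norm_smul, norm_column, mul_one, Real.norm_of_nonneg hγ.le] at h1
    have h2 : ‖inner ℝ (column U j) v‖ ≤ ‖v‖ := by
      simpa [norm_column] using norm_inner_le_norm (𝕜 := ℝ) (column U j) v
    have h3 : ‖γ⁻¹ • (f (x + γ • column U j) - f x - act (jac f x) (γ • column U j))‖ ≤ κ * γ := by
      rw [norm_smul, norm_inv, Real.norm_of_nonneg hγ.le, inv_mul_le_iff₀ hγ]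
      linarith
    rw [norm_smul, mul_comm]
    exact mul_le_mul h3 h2 (norm_nonneg _) (by positivity)
  refine (Finset.sum_le_sum hterm).trans (le_of_eq ?_)
  simp; ring

end Jacobian

end DFLM

/-! ### The Levenberg–Marquardt step -/

namespace DFLM

section LevenbergMarquardt

variable {ι κ : Type*} [Fintype ι] [Fintype κ]
  {A : Matrix ι κ ℝ} {g d : EuclideanSpace ℝ κ} {μ b : ℝ}

theorem levenbergMarquardt_equation [DecidableEq κ] (A : Matrix ι κ ℝ) (g : EuclideanSpace ℝ κ) (hμ : 0 < μ) :
    act Aᵀ (act A (act (Aᵀ * A + μ • (1 : Matrix κ κ ℝ))⁻¹ (-g)))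
      + μ • act (Aᵀ * A + μ • (1 : Matrix κ κ ℝ))⁻¹ (-g) = -g := by
  have hpd : (Aᵀ * A + μ • (1 : Matrix κ κ ℝ)).PosDef := by
    have h1 : (Aᵀ * A).PosSemidef := by
      simpa using Matrix.posSemidef_conjTranspose_mul_self A
    exact Matrix.PosDef.posSemidef_add h1 (Matrix.PosDef.one.smul hμ)
  have hu : IsUnit (Aᵀ * A + μ • (1 : Matrix κ κ ℝ)).det :=
    (Matrix.isUnit_iff_isUnit_det _).1 hpd.isUnit
  set M := Aᵀ * A + μ • (1 : Matrix κ κ ℝ) with hM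
  have h : M *ᵥ (M⁻¹ *ᵥ (-g).ofLp) = (-g).ofLp := by
    rw [Matrix.mulVec_mulVec, Matrix.mul_nonsing_inv _ hu, Matrix.one_mulVec]
  nth_rewrite 1 [hM] at h
  rw [Matrix.add_mulVec, Matrix.smul_mulVec, Matrix.one_mulVec, ← Matrix.mulVec_mulVec] at h
  ext i
  exact congrFun h i

variable (h : act Aᵀ (act A d) + μ • d = -g)
include h

theorem inner_grad_step : inner ℝ g d = -(‖act A d‖ ^ 2 + μ * ‖d‖ ^ 2) := by
  have h1 : inner ℝ (act Aᵀ (act A d) + μ • d) d = inner ℝ (-g) d := by rw [h]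
  rw [inner_add_left, inner_act_transpose, inner_neg_left, real_inner_smul_left,
    real_inner_self_eq_norm_sq, real_inner_self_eq_norm_sq] at h1
  linarith

/-- Cauchy–Schwarz in `inner_grad_step`. With `μ = λ‖g‖` the factor `‖g‖` cancels and `‖d‖ ≤ 1/λ`.
-/
theorem mul_norm_step_le : μ * ‖d‖ ≤ ‖g‖ := by
  rcases (norm_nonneg d).eq_or_lt with h0 | h0
  · rw [← h0, mul_zero]; exact norm_nonneg g
  · have h1 := inner_grad_step h
    have h2 := neg_le_of_abs_le (abs_real_inner_le_norm g d)
    have h3 : μ * ‖d‖ * ‖d‖ ≤ ‖g‖ * ‖d‖ := by nlinarith [sq_nonneg ‖act A d‖]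
    exact le_of_mul_le_mul_right h3 h0

theorem norm_grad_le_mul_norm_step [DecidableEq ι] [DecidableEq κ] (hμ : 0 ≤ μ) (hb : ‖A‖ ≤ b) :
    ‖g‖ ≤ (b ^ 2 + μ) * ‖d‖ := by
  have hb0 : 0 ≤ b := (norm_nonneg A).trans hb
  have h1 : ‖act Aᵀ (act A d)‖ ≤ b * (b * ‖d‖) := by
    refine (norm_act_le _ _).trans ?_
    rw [norm_transpose_eq]
    gcongr
    exact (norm_act_le _ _).trans (by gcongr)
  calc ‖g‖ = ‖act Aᵀ (act A d) + μ • d‖ := by rw [h, norm_neg]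
    _ ≤ ‖act Aᵀ (act A d)‖ + ‖μ • d‖ := norm_add_le _ _
    _ ≤ b * (b * ‖d‖) + μ * ‖d‖ := by
      rw [norm_smul, Real.norm_of_nonneg hμ]; gcongr
    _ = _ := by ring

variable {φ : EuclideanSpace ℝ ι} (hg : act Aᵀ φ = g)
include hg

theorem predicted_reduction_eq :
    ‖φ‖ ^ 2 - ‖φ + act A d‖ ^ 2 = ‖act A d‖ ^ 2 + 2 * (μ * ‖d‖ ^ 2) := by
  have h1 := inner_grad_step h
  rw [← hg, inner_act_transpose] at h1
  rw [norm_add_sq_real]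
  linarith

/-- The actual reduction dominates the predicted one once the linear model is accurate and the
regularization is large. -/
theorem mul_predicted_reduction_le [DecidableEq ι] [DecidableEq κ] {φ' : EuclideanSpace ℝ ι} {B η ε ρ : ℝ}
    (hb : ‖A‖ ≤ b) (hμ0 : 0 ≤ μ) (hμ : b ^ 2 ≤ μ) (hB : ‖φ‖ ≤ B) (hε : ε ≤ ‖g‖) (hρ : ρ ≤ 1)
    (he : ‖φ' - (φ + act A d)‖ ≤ η * ‖d‖) (he1 : η * ‖d‖ ≤ 1)
    (hη : (2 * B + 1) * η ≤ (1 - ρ) * ε) :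
    ρ * (‖φ‖ ^ 2 - ‖φ + act A d‖ ^ 2) ≤ ‖φ‖ ^ 2 - ‖φ'‖ ^ 2 := by
  have hpred := predicted_reduction_eq h hg
  have hgd := norm_grad_le_mul_norm_step h hμ0 hb
  have hd := norm_nonneg d
  set a := φ + act A d with ha
  set e := φ' - a with he'
  have hpos : 0 ≤ μ * ‖d‖ ^ 2 := by positivity
  have haB : ‖a‖ ≤ B := by
    refine le_trans ?_ hB
    refine le_of_sq_le_sq ?_ (norm_nonneg _)
    nlinarith [sq_nonneg ‖act A d‖]
  have hφ' : ‖φ'‖ ≤ ‖a‖ + ‖e‖ := by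
    have : φ' = a + e := by rw [he']; abel
    rw [this]; exact norm_add_le _ _
  -- The factor is `2‖a‖ + ‖e‖`, with `‖a‖ ≤ B` and `‖e‖ ≤ 1`.
  have hsq : ‖φ'‖ ^ 2 ≤ ‖a‖ ^ 2 + (2 * B + 1) * ‖e‖ := by
    have h2 : ‖φ'‖ ^ 2 ≤ (‖a‖ + ‖e‖) ^ 2 := pow_le_pow_left₀ (norm_nonneg _) hφ' 2
    nlinarith [norm_nonneg a, norm_nonneg e, mul_le_mul_of_nonneg_right haB (norm_nonneg e),
      mul_le_mul_of_nonneg_right (he.trans he1) (norm_nonneg e)]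
  have hB0 : 0 ≤ B := (norm_nonneg _).trans hB
  have h3 : (2 * B + 1) * ‖e‖ ≤ (1 - ρ) * (ε * ‖d‖) := by
    calc (2 * B + 1) * ‖e‖ ≤ (2 * B + 1) * (η * ‖d‖) := by gcongr
      _ = (2 * B + 1) * η * ‖d‖ := by ring
      _ ≤ (1 - ρ) * ε * ‖d‖ := by gcongr
      _ = _ := by ring
  -- Since `b² ≤ μ`, `ε ≤ ‖g‖ ≤ 2μ‖d‖`, while the predicted reduction is at least `2μ‖d‖²`.
  have h4 : ε * ‖d‖ ≤ ‖φ‖ ^ 2 - ‖a‖ ^ 2 := by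
    have h5 : ε ≤ 2 * μ * ‖d‖ := by nlinarith [mul_le_mul_of_nonneg_right hμ hd]
    nlinarith [mul_le_mul_of_nonneg_right h5 hd, sq_nonneg ‖act A d‖]
  have h6 : (1 - ρ) * (ε * ‖d‖) ≤ (1 - ρ) * (‖φ‖ ^ 2 - ‖a‖ ^ 2) :=
    mul_le_mul_of_nonneg_left h4 (by linarith)
  linarith

end LevenbergMarquardt

/-! ### The stacked residual and its linear model -/

section Stack

variable {n p m : ℕ}

/-- Concatenation of two Euclidean vectors. -/
def stack (a : Vec p) (b : Vec m) : EuclideanSpace ℝ (Fin p ⊕ Fin m) :=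
  WithLp.toLp 2 (Sum.elim a.ofLp b.ofLp)

theorem norm_stack_le (a : Vec p) (b : Vec m) : ‖stack a b‖ ≤ ‖a‖ + ‖b‖ := by
  have h : ‖stack a b‖ ^ 2 = ‖a‖ ^ 2 + ‖b‖ ^ 2 := by
    simp [EuclideanSpace.norm_sq_eq, stack]
  refine le_of_sq_le_sq ?_ (by positivity)
  nlinarith [norm_nonneg a, norm_nonneg b]

theorem stack_sub (a a' : Vec p) (b b' : Vec m) :
    stack a b - stack a' b' = stack (a - a') (b - b') := by
  ext i; cases i <;> simp [stack]

theorem stack_add (a a' : Vec p) (b b' : Vec m) :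
    stack a b + stack a' b' = stack (a + a') (b + b') := by
  ext i; cases i <;> simp [stack]

namespace State

variable (s : State n p m)

theorem act_JPhi (v : Vec n) :
    act s.JPhi v = stack (act s.Jr v) ((Real.sqrt s.δ)⁻¹ • act s.Jc v) := by
  ext i; cases i <;> simp [stack, act, JPhi, Matrix.fromRows_mulVec, Matrix.smul_mulVec]

theorem act_JPhi_transpose_stack (a : Vec p) (b : Vec m) :
    act s.JPhiᵀ (stack a b) = act s.Jrᵀ a + (Real.sqrt s.δ)⁻¹ • act s.Jcᵀ b := by
  ext i
  simp [stack, act, JPhi, Matrix.transpose_fromRows, Matrix.fromCols_mulVec, Matrix.smul_mulVec]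

theorem norm_JPhi_le {B : ℝ} (hr : ‖s.Jr‖ ≤ B) (hc : ‖s.Jc‖ ≤ B) :
    ‖s.JPhi‖ ≤ B + (Real.sqrt s.δ)⁻¹ * B := by
  have hB : 0 ≤ B := (norm_nonneg _).trans hr
  refine norm_le_of_norm_act_le _ (by positivity) fun v => ?_
  rw [act_JPhi]
  refine (norm_stack_le _ _).trans ?_
  rw [norm_smul, Real.norm_of_nonneg (by positivity), add_mul, mul_assoc]
  gcongr
  · exact (norm_act_le _ _).trans (by gcongr)
  · exact (norm_act_le _ _).trans (by gcongr)

end State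

namespace Input

variable (D : Input n p m) (s : State n p m)

theorem bigPhi_eq_stack (x : Vec n) (δ : ℝ) :
    D.bigPhi x δ = stack (D.r x) ((Real.sqrt δ)⁻¹ • (D.c x - δ • D.yk)) := rfl

/-- The two factors `δ^{-1/2}` combine to `δ⁻¹`. This identifies `∇φ_s` with the Gauss–Newton
gradient of `½‖Φ_k‖²`, so the abstract step lemmas apply. -/
theorem act_JPhi_transpose_bigPhi (hδ : 0 < s.δ) :
    act s.JPhiᵀ (D.bigPhi s.x s.δ) = D.grad s := by
  have h : (Real.sqrt s.δ)⁻¹ * (Real.sqrt s.δ)⁻¹ = s.δ⁻¹ := by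
    rw [← mul_inv, Real.mul_self_sqrt hδ.le]
  rw [bigPhi_eq_stack, State.act_JPhi_transpose_stack, act_smul, smul_smul, h, act_sub, act_smul,
    smul_sub, smul_smul, inv_mul_cancel₀ hδ.ne', one_smul, grad, gradPhi]
  abel

theorem norm_bigPhi_le {x : Vec n} {δ B : ℝ} (hr : ‖D.r x‖ ≤ B) (hc : ‖D.c x‖ ≤ B) (hδ : 0 ≤ δ) :
    ‖D.bigPhi x δ‖ ≤ B + (Real.sqrt δ)⁻¹ * (B + δ * ‖D.yk‖) := by
  rw [bigPhi_eq_stack]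
  refine (norm_stack_le _ _).trans ?_
  rw [norm_smul, Real.norm_of_nonneg (by positivity)]
  gcongr
  refine (norm_sub_le _ _).trans ?_
  rw [norm_smul, Real.norm_of_nonneg hδ]
  gcongr

theorem lmStep_equation (hlam : 0 < s.lam) (hg : D.grad s ≠ 0) :
    act s.JPhiᵀ (act s.JPhi (D.lmStep s)) + (s.lam * ‖D.grad s‖) • D.lmStep s = -D.grad s :=
  levenbergMarquardt_equation _ _ (mul_pos hlam (norm_pos_iff.2 hg))

theorem lmStep_ne_zero (hlam : 0 < s.lam) (hg : D.grad s ≠ 0) : D.lmStep s ≠ 0 := by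
  intro h0
  have := D.lmStep_equation s hlam hg
  rw [h0, smul_zero, add_zero] at this
  exact hg (by simpa [act] using this.symm)

theorem norm_lmStep_le (hlam : 0 < s.lam) (hg : D.grad s ≠ 0) : ‖D.lmStep s‖ ≤ s.lam⁻¹ := by
  have h := mul_norm_step_le (D.lmStep_equation s hlam hg)
  have hg' := norm_pos_iff.2 hg
  rw [le_inv_comm₀ (norm_pos_iff.2 (D.lmStep_ne_zero s hlam hg)) hlam,
    ← one_div, le_div_iff₀ (norm_pos_iff.2 (D.lmStep_ne_zero s hlam hg))]
  nlinarith

theorem predicted_reduction_pos (hlam : 0 < s.lam) (hg : D.grad s ≠ 0) (hδ : 0 < s.δ) :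
    0 < ‖D.bigPhi s.x s.δ‖ ^ 2 - ‖D.bigPhi s.x s.δ + act s.JPhi (D.lmStep s)‖ ^ 2 := by
  rw [predicted_reduction_eq (D.lmStep_equation s hlam hg) (D.act_JPhi_transpose_bigPhi s hδ)]
  have := norm_pos_iff.2 (D.lmStep_ne_zero s hlam hg)
  have := norm_pos_iff.2 hg
  positivity

theorem le_ratio_iff (hlam : 0 < s.lam) (hg : D.grad s ≠ 0) (hδ : 0 < s.δ) (ρ : ℝ) :
    ρ ≤ D.ratio s ↔
      ρ * (‖D.bigPhi s.x s.δ‖ ^ 2 - ‖D.bigPhi s.x s.δ + act s.JPhi (D.lmStep s)‖ ^ 2) ≤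
        ‖D.bigPhi s.x s.δ‖ ^ 2 - ‖D.bigPhi (s.x + D.lmStep s) s.δ‖ ^ 2 :=
  le_div_iff₀ (D.predicted_reduction_pos s hlam hg hδ)

/-- Accuracy of the linear model of `Φ_k` at `s`. -/
theorem norm_bigPhi_sub_model_le (hr : ContDiff ℝ 1 D.r) (hc : ContDiff ℝ 1 D.c)
    {κ : ℝ} (hκ : 0 ≤ κ)
    (hljr : ∀ x y, ‖jac D.r x - jac D.r y‖ ≤ κ * ‖x - y‖)
    (hljc : ∀ x y, ‖jac D.c x - jac D.c y‖ ≤ κ * ‖x - y‖)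
    (hsr : ‖s.Jr - jac D.r s.x‖ ≤ n * κ * s.γ) (hsc : ‖s.Jc - jac D.c s.x‖ ≤ n * κ * s.γ)
    (d : Vec n) :
    ‖D.bigPhi (s.x + d) s.δ - (D.bigPhi s.x s.δ + act s.JPhi d)‖ ≤
      (1 + (Real.sqrt s.δ)⁻¹) * (n * κ * s.γ + κ * ‖d‖) * ‖d‖ := by
  have key : ∀ {q : ℕ} {f : Vec n → Vec q} {J : Matrix (Fin q) (Fin n) ℝ}, ContDiff ℝ 1 f →
      (∀ x y, ‖jac f x - jac f y‖ ≤ κ * ‖x - y‖) → ‖J - jac f s.x‖ ≤ n * κ * s.γ →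
      ‖f (s.x + d) - f s.x - act J d‖ ≤ (n * κ * s.γ + κ * ‖d‖) * ‖d‖ := by
    intro q f J hf hl hJ
    have h1 := norm_taylor_remainder_le hf hκ hl s.x d
    have h2 : ‖act (J - jac f s.x) d‖ ≤ n * κ * s.γ * ‖d‖ :=
      (norm_act_le _ _).trans (by gcongr)
    calc ‖f (s.x + d) - f s.x - act J d‖
        = ‖(f (s.x + d) - f s.x - act (jac f s.x) d) - act (J - jac f s.x) d‖ := by
          rw [sub_act]; congr 1; abel
      _ ≤ κ * ‖d‖ ^ 2 + n * κ * s.γ * ‖d‖ := (norm_sub_le _ _).trans (add_le_add h1 h2)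
      _ = _ := by ring
  have h1 := key hr hljr hsr
  have h2 := key hc hljc hsc
  have heq : D.bigPhi (s.x + d) s.δ - (D.bigPhi s.x s.δ + act s.JPhi d)
      = stack (D.r (s.x + d) - D.r s.x - act s.Jr d)
        ((Real.sqrt s.δ)⁻¹ • (D.c (s.x + d) - D.c s.x - act s.Jc d)) := by
    rw [State.act_JPhi, bigPhi_eq_stack, bigPhi_eq_stack, stack_add, stack_sub]
    congr 1
    · abel
    · rw [← smul_add, ← smul_sub]; congr 1; abel
  rw [heq]
  refine (norm_stack_le _ _).trans ?_
  rw [norm_smul, Real.norm_of_nonneg (by positivity), mul_assoc, add_mul, one_mul]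
  gcongr

end Input

end Stack

end DFLM

/-! ### A single inner iteration -/

namespace DFLM

namespace Input

variable {n p m : ℕ} (D : Input n p m)

/-- A large `λ` acts twice: it shortens the step to `1/λ`, which controls the model error, and it
makes `λ‖g‖` dominate `‖J‖²`. -/
theorem le_ratio_of_large_lam {s : State n p m} (hr : ContDiff ℝ 1 D.r) (hc : ContDiff ℝ 1 D.c)
    {κ B ε η ρ : ℝ} (hκ : 0 ≤ κ)
    (hljr : ∀ x y, ‖jac D.r x - jac D.r y‖ ≤ κ * ‖x - y‖)
    (hljc : ∀ x y, ‖jac D.c x - jac D.c y‖ ≤ κ * ‖x - y‖)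
    (hsr : ‖s.Jr - jac D.r s.x‖ ≤ n * κ * s.γ) (hsc : ‖s.Jc - jac D.c s.x‖ ≤ n * κ * s.γ)
    (hδ : 0 < s.δ) (hΦ : ‖D.bigPhi s.x s.δ‖ ≤ B) (hε : 0 < ε) (hg : ε ≤ ‖D.grad s‖) (hρ : ρ ≤ 1)
    (hη1 : η ≤ 1) (hη : (2 * B + 1) * η ≤ (1 - ρ) * ε) (hlam1 : 1 ≤ s.lam)
    (hJ : ‖s.JPhi‖ ^ 2 ≤ s.lam * ε)
    (hγ : (1 + (Real.sqrt s.δ)⁻¹) * (n * κ * s.γ + κ * s.lam⁻¹) ≤ η) :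
    ρ ≤ D.ratio s := by
  have hlam : 0 < s.lam := by linarith
  have hg0 : D.grad s ≠ 0 := norm_pos_iff.1 (hε.trans_le hg)
  have hd := D.norm_lmStep_le s hlam hg0
  have hd1 : ‖D.lmStep s‖ ≤ 1 := hd.trans (inv_le_one_of_one_le₀ hlam1)
  have hη' : (1 + (Real.sqrt s.δ)⁻¹) * (n * κ * s.γ + κ * ‖D.lmStep s‖) ≤ η := by
    refine le_trans ?_ hγ
    gcongr
  rw [D.le_ratio_iff s hlam hg0 hδ]
  refine mul_predicted_reduction_le (D.lmStep_equation s hlam hg0)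
    (D.act_JPhi_transpose_bigPhi s hδ) le_rfl (by positivity)
    (hJ.trans (by gcongr)) hΦ hg hρ
    ((D.norm_bigPhi_sub_model_le s hr hc hκ hljr hljc hsr hsc _).trans
      (mul_le_mul_of_nonneg_right hη' (norm_nonneg _))) ?_ hη
  have := mul_le_mul_of_nonneg_right hη1 (norm_nonneg (D.lmStep s))
  linarith

/-- A uniform lower bound for the predicted reduction. -/
theorem le_predicted_reduction {s : State n p m} {b ε G l M : ℝ} (hδ : 0 < s.δ) (hε : 0 < ε)
    (hg : ε ≤ ‖D.grad s‖) (hG : ‖D.grad s‖ ≤ G) (hl : 0 < l) (hl' : l ≤ s.lam) (hM : s.lam ≤ M)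
    (hJ : ‖s.JPhi‖ ≤ b) :
    2 * (l * ε * (ε / (b ^ 2 + M * G)) ^ 2) ≤
      ‖D.bigPhi s.x s.δ‖ ^ 2 - ‖D.bigPhi s.x s.δ + act s.JPhi (D.lmStep s)‖ ^ 2 := by
  have hlam : 0 < s.lam := hl.trans_le hl'
  have hg0 : D.grad s ≠ 0 := norm_pos_iff.1 (hε.trans_le hg)
  have hG0 : 0 < G := (hε.trans_le hg).trans_le hG
  have hM0 : 0 < M := hlam.trans_le hM
  have heq := D.lmStep_equation s hlam hg0
  have h1 := norm_grad_le_mul_norm_step heq (by positivity) hJ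
  rw [predicted_reduction_eq heq (D.act_JPhi_transpose_bigPhi s hδ)]
  have hd : ε / (b ^ 2 + M * G) ≤ ‖D.lmStep s‖ := by
    rw [div_le_iff₀ (by positivity), mul_comm]
    refine (hg.trans h1).trans ?_
    gcongr
  have h2 : l * ε * (ε / (b ^ 2 + M * G)) ^ 2 ≤
      s.lam * ‖D.grad s‖ * ‖D.lmStep s‖ ^ 2 := by gcongr
  have := sq_nonneg ‖act s.JPhi (D.lmStep s)‖
  linarith

theorem lamMin_le_nextLam {s : State n p m} (hs : D.lamMin ≤ s.lam) (hpos : 0 < s.lam) :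
    D.lamMin ≤ D.nextLam s := by
  unfold nextLam
  split_ifs
  · linarith
  · linarith
  · exact hs
  · exact le_max_right _ _

theorem nextLam_le {s : State n p m} (hmin : 0 < D.lamMin) (hs : D.lamMin ≤ s.lam) :
    D.nextLam s ≤ 4 * s.lam := by
  unfold nextLam
  split_ifs
  · exact le_rfl
  · exact le_rfl
  · linarith
  · exact max_le (by linarith) (by linarith)

/-- An accepted step with `‖g‖ ≥ p₂/λ` excludes all branches but the last. -/
theorem nextLam_le_self {s : State n p m} (hmin : 0 < D.lamMin) (hs : D.lamMin ≤ s.lam)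
    (hδ : 0 < s.δ) (hp : D.p1 ≤ D.p2) (hρ : D.p0 ≤ D.ratio s) (hg : D.p2 ≤ s.lam * ‖D.grad s‖) :
    D.nextLam s ≤ s.lam := by
  have hlam : 0 < s.lam := hmin.trans_le hs
  unfold nextLam
  rw [D.act_JPhi_transpose_bigPhi s hδ, if_neg hρ.not_gt, if_neg, if_neg]
  · exact max_le (by linarith) hs
  · rw [not_lt, div_le_iff₀ hlam]; linarith
  · rw [not_lt, div_le_iff₀ hlam]; linarith

theorem gradPhi_eq_gradL (Jr : Matrix (Fin p) (Fin n) ℝ) (Jc : Matrix (Fin m) (Fin n) ℝ)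
    (x : Vec n) (δ : ℝ) : D.gradPhi Jr Jc x δ = D.gradL Jr Jc x (D.yk - δ⁻¹ • D.c x) := by
  rw [gradPhi, gradL, act_sub, act_smul]; abel

/-- If the penalty parameter is not decreased and the gradient of the augmented Lagrangian is small,
then the sufficient decrease condition holds. -/
theorem sufficientDecrease_step (hD : D.Valid) (s : State n p m) (V : St n)
    (hδ : (D.step s V).δ = s.δ) (hs : 0 < s.δ) (hg : ‖D.grad (D.step s V)‖ ≤ 1 / 2 * D.εk) :
    D.SufficientDecrease (D.step s V) := by
  have hδ' : D.nextδ s V = s.δ := hδ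
  have hgL : D.grad (D.step s V) = D.gradL (D.nextJr s V) (D.nextJc s V) (D.nextX s)
      (D.yk - s.δ⁻¹ • D.c (D.nextX s)) := by
    rw [← gradPhi_eq_gradL, ← hδ']; rfl
  -- Otherwise both halves of the penalty test would hold and `δ` would have dropped.
  have hc : ‖D.c (D.nextX s)‖ ≤ D.θ * ‖D.c D.xk‖ + 1 / 2 * D.εk := by
    by_contra! hcon
    have h : D.nextδ s V = 1 / 10 * s.δ := by
      unfold nextδ
      refine if_pos ⟨?_, hcon⟩
      rw [← hgL]
      have := mul_nonneg hD.θ_pos.le (norm_nonneg (D.gradL D.Jrk D.Jck D.xk D.yk))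
      linarith
    linarith
  have hm : D.meritState (D.step s V) = ‖D.grad (D.step s V)‖ + ‖D.c (D.nextX s)‖ := by
    rw [hgL, ← hδ']
    simp [meritState, merit, step, gradL]
  have hk : ‖D.c D.xk‖ ≤ D.meritk := by
    unfold meritk merit
    linarith [norm_nonneg (act D.Jrkᵀ D.zk - act D.Jckᵀ D.yk), norm_nonneg (D.zk - D.r D.xk)]
  unfold SufficientDecrease
  rw [hm]
  nlinarith [mul_le_mul_of_nonneg_left hk hD.θ_pos.le]

/-! ### Invariants of the run -/

section Run

variable (u : ℕ → St n)

theorem run_succ_of_not {j : ℕ} (h : j ≠ 0 → ¬ D.SufficientDecrease (D.run u j)) :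
    D.run u (j + 1) = D.step (D.run u j) (u j) := by
  rw [run, if_neg]
  rintro ⟨h0, h1⟩
  exact h h0 h1

theorem run_succ_of_sufficientDecrease {j : ℕ} (h : D.SufficientDecrease (D.run u (j + 1))) :
    D.run u (j + 2) = D.run u (j + 1) := by
  rw [run, if_pos ⟨j.succ_ne_zero, h⟩]

theorem run_succ_eq_or (j : ℕ) :
    D.run u (j + 1) = D.run u j ∨ D.run u (j + 1) = D.step (D.run u j) (u j) := by
  rw [run]
  split_ifs
  · exact Or.inl rfl
  · exact Or.inr rfl

theorem lamMin_le_lam (hD : D.Valid) (j : ℕ) : D.lamMin ≤ (D.run u j).lam := by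
  induction j with
  | zero => exact hD.lamMin_lt.le
  | succ j ih =>
    rcases D.run_succ_eq_or u j with h | h <;> rw [h]
    · exact ih
    · exact D.lamMin_le_nextLam ih (hD.lamMin_pos.trans_le ih)

theorem δ_pos (hD : D.Valid) (j : ℕ) : 0 < (D.run u j).δ := by
  induction j with
  | zero => exact hD.δk_pos
  | succ j ih =>
    rcases D.run_succ_eq_or u j with h | h <;> rw [h]
    · exact ih
    · change 0 < D.nextδ _ _
      unfold nextδ
      split_ifs
      · positivity
      · exact ih

theorem exists_eq_approxJac (j : ℕ) : ∃ V : St n,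
    (D.run u j).Jr = approxJac D.r (D.run u j).γ V (D.run u j).x ∧
    (D.run u j).Jc = approxJac D.c (D.run u j).γ V (D.run u j).x := by
  induction j with
  | zero => exact ⟨D.Uk, rfl, rfl⟩
  | succ j ih =>
    rcases D.run_succ_eq_or u j with h | h <;> rw [h]
    · exact ih
    · exact ⟨u j, rfl, rfl⟩

variable {u}

section NonTerminating

variable (hD : D.Valid) (hnt : ∀ j, ¬ D.SufficientDecrease (D.run u (j + 1)))
include hD hnt

omit hD in
theorem run_succ (j : ℕ) : D.run u (j + 1) = D.step (D.run u j) (u j) := by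
  refine D.run_succ_of_not u fun hj => ?_
  obtain ⟨i, rfl⟩ := Nat.exists_eq_succ_of_ne_zero hj
  exact hnt i

theorem half_εk_lt_norm_grad {j : ℕ} (hδ : (D.run u (j + 1)).δ = (D.run u j).δ) :
    1 / 2 * D.εk < ‖D.grad (D.run u (j + 1))‖ := by
  by_contra! hcon
  apply hnt j
  rw [D.run_succ hnt] at hδ hcon ⊢
  exact D.sufficientDecrease_step hD _ _ hδ (D.δ_pos u hD j) hcon

/-- Only `min (γ/2) ‖d‖` could vanish. That branch requires the preceding update to have kept `δ`,
so the gradient exceeds `ε_k/2` and `d ≠ 0`; at index 0 the assumption on the initial gradient takes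
over. -/
theorem γ_pos (j : ℕ) : 0 < (D.run u j).γ := by
  induction j with
  | zero => exact hD.γk_pos
  | succ j ih =>
    have hγk := hD.γk_pos
    rw [D.run_succ hnt]
    change 0 < D.nextγ _
    unfold nextγ
    split_ifs with h
    · refine lt_min (by positivity) (norm_pos_iff.2 ?_)
      refine D.lmStep_ne_zero _ (hD.lamMin_pos.trans_le (D.lamMin_le_lam u hD j)) ?_
      rcases j with _ | j
      · exact hD.grad_ne_zero
      · have hprev : (D.run u (j + 1)).δprev = (D.run u j).δ := by rw [D.run_succ hnt]; rfl
        have hε := hD.εk_pos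
        exact norm_pos_iff.1 (lt_trans (by positivity)
          (D.half_εk_lt_norm_grad hD hnt (h.trans hprev)))
    · positivity
    · exact ih
    · exact lt_min (by positivity) hγk

theorem norm_jacobian_error_le (hr : ContDiff ℝ 1 D.r) (hc : ContDiff ℝ 1 D.c)
    {κ : ℝ} (hκ : 0 ≤ κ)
    (hljr : ∀ x y, ‖jac D.r x - jac D.r y‖ ≤ κ * ‖x - y‖)
    (hljc : ∀ x y, ‖jac D.c x - jac D.c y‖ ≤ κ * ‖x - y‖) (j : ℕ) :
    ‖(D.run u j).Jr - jac D.r (D.run u j).x‖ ≤ n * κ * (D.run u j).γ ∧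
    ‖(D.run u j).Jc - jac D.c (D.run u j).x‖ ≤ n * κ * (D.run u j).γ := by
  obtain ⟨V, h1, h2⟩ := D.exists_eq_approxJac u j
  have hγ := D.γ_pos hD hnt j
  rw [h1, h2]
  exact ⟨norm_approxJac_sub_jac_le hr hκ hljr hγ V _, norm_approxJac_sub_jac_le hc hκ hljc hγ V _⟩

omit hD in
theorem γ_succ_le_half {j : ℕ} (hδ : (D.run u (j + 1)).δ = (D.run u j).δ) :
    (D.run u (j + 2)).γ ≤ 1 / 2 * (D.run u (j + 1)).γ := by
  have hprev : (D.run u (j + 1)).δprev = (D.run u j).δ := by rw [D.run_succ hnt]; rfl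
  rw [D.run_succ hnt (j + 1)]
  change D.nextγ _ ≤ _
  unfold nextγ
  rw [if_pos (hδ.trans hprev.symm)]
  exact min_le_left _ _

omit hD in
-- In the second case the gradient is taken at the new point with the old `δ`, as in the penalty
-- test.
theorem δ_succ_eq_or (j : ℕ) : (D.run u (j + 1)).δ = (D.run u j).δ ∨
    ((D.run u (j + 1)).δ = 1 / 10 * (D.run u j).δ ∧
      ‖D.gradPhi (D.run u (j + 1)).Jr (D.run u (j + 1)).Jc (D.run u (j + 1)).x (D.run u j).δ‖
        ≤ D.θ * ‖D.gradL D.Jrk D.Jck D.xk D.yk‖ + 1 / 2 * D.εk) := by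
  rw [D.run_succ hnt]
  simp only [step, gradPhi_eq_gradL]
  unfold nextδ
  split_ifs with h
  · exact Or.inr ⟨rfl, h.1⟩
  · exact Or.inl rfl

theorem δ_antitone : Antitone fun j => (D.run u j).δ := by
  refine antitone_nat_of_succ_le fun j => ?_
  have := D.δ_pos u hD j
  rcases D.δ_succ_eq_or hnt j with h | ⟨h, -⟩ <;> rw [h]
  linarith

end NonTerminating

end Run

end Input

end DFLM

/-! ### Asymptotics of a run that never returns -/

namespace DFLM

/-- Eventual halving above `η` brings the sequence below `η`. From there one doubling reaches less
than `2η`, and any value in `[η, 2η]` is halved again, so `2η` is never exceeded. -/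
theorem tendsto_zero_of_eventually_halved {a : ℕ → ℝ} (h0 : ∀ k, 0 ≤ a k)
    (h1 : ∀ k, a (k + 1) ≤ 2 * a k)
    (h2 : ∀ η, 0 < η → ∀ᶠ k in atTop, η ≤ a k → a (k + 1) ≤ 1 / 2 * a k) :
    Tendsto a atTop (nhds 0) := by
  have key : ∀ η, 0 < η → ∀ᶠ k in atTop, a k ≤ 2 * η := by
    intro η hη
    obtain ⟨N, hN⟩ := eventually_atTop.1 (h2 η hη)
    have hex : ∃ k, N ≤ k ∧ a k < η := by
      by_contra! hcon
      have hgeo : ∀ i, a (N + i) ≤ (1 / 2) ^ i * a N := by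
        intro i
        induction i with
        | zero => simp
        | succ i ih =>
          have := hN (N + i) (by omega) (hcon (N + i) (by omega))
          rw [← add_assoc, pow_succ]
          linarith
      have hlim : Tendsto (fun i : ℕ => (1 / 2 : ℝ) ^ i * a N) atTop (nhds (0 * a N)) :=
        (tendsto_pow_atTop_nhds_zero_of_lt_one (by norm_num) (by norm_num)).mul_const _
      rw [zero_mul] at hlim
      obtain ⟨i, hi⟩ := (hlim.eventually (gt_mem_nhds hη)).exists
      exact absurd (hgeo i) (not_le.2 (hi.trans_le (hcon _ (by omega))))
    obtain ⟨k, hk, hak⟩ := hex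
    refine eventually_atTop.2 ⟨k, fun j hj => ?_⟩
    induction j, hj using Nat.le_induction with
    | base => linarith
    | succ j hj ih =>
      rcases le_or_gt η (a j) with h | h
      · linarith [hN j (hk.trans hj) h]
      · linarith [h1 j]
  rw [Metric.tendsto_atTop]
  intro e he
  obtain ⟨N, hN⟩ := eventually_atTop.1 (key (e / 4) (by positivity))
  refine ⟨N, fun j hj => ?_⟩
  rw [Real.dist_eq, sub_zero, abs_of_nonneg (h0 j)]
  linarith [hN j hj]

theorem eventually_sub_succ_lt {h : ℕ → ℝ} {L c : ℝ} (hL : Tendsto h atTop (nhds L)) (hc : 0 < c) :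
    ∀ᶠ k in atTop, h k - h (k + 1) < c := by
  have := hL.sub (hL.comp (tendsto_add_atTop_nat 1))
  rw [sub_self] at this
  exact this.eventually (gt_mem_nhds hc)

namespace Input

variable {n p m : ℕ} (D : Input n p m) {u : ℕ → St n}

theorem nextγ_le_two_mul {s : State n p m} (hγ : 0 ≤ s.γ) : D.nextγ s ≤ 2 * s.γ := by
  unfold nextγ
  split_ifs
  · exact (min_le_left _ _).trans (by linarith)
  · linarith
  · linarith
  · exact min_le_left _ _

section NonTerminating

variable (hD : D.Valid) (hnt : ∀ j, ¬ D.SufficientDecrease (D.run u (j + 1)))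
include hD hnt

theorem γ_succ_le_two_mul (j : ℕ) : (D.run u (j + 1)).γ ≤ 2 * (D.run u j).γ := by
  have h := D.nextγ_le_two_mul (D.γ_pos hD hnt j).le
  rwa [D.run_succ hnt]

/-- The penalty parameter tends to zero if it decreases infinitely often. -/
theorem tendsto_δ (hinf : {j | (D.run u (j + 1)).δ < (D.run u j).δ}.Infinite) :
    Tendsto (fun j => (D.run u j).δ) atTop (nhds 0) := by
  have hbdd : BddBelow (Set.range fun j => (D.run u j).δ) :=
    ⟨0, by rintro _ ⟨j, rfl⟩; exact (D.δ_pos u hD j).le⟩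
  have hL := tendsto_atTop_ciInf (D.δ_antitone hD hnt) hbdd
  set L := ⨅ j, (D.run u j).δ with hLdef
  have hL0 : 0 ≤ L := le_ciInf fun j => (D.δ_pos u hD j).le
  rcases hL0.eq_or_lt with h | h
  · rwa [← h] at hL
  · exfalso
    -- With a positive limit `L`, each drop would cost at least `9/10 * L`, which convergence
    -- forbids in the long run.
    have hev := eventually_sub_succ_lt hL (show 0 < 9 / 10 * L by positivity)
    obtain ⟨j, hj, hj'⟩ := ((Nat.frequently_atTop_iff_infinite.2 hinf).and_eventually hev).exists
    have hle : L ≤ (D.run u j).δ := ciInf_le hbdd j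
    rcases D.δ_succ_eq_or hnt j with h1 | ⟨h1, -⟩
    · exact hj.ne h1
    · rw [h1] at hj'; linarith

omit hD in
/-- At a decrease of the penalty parameter, the approximate gradient of `½‖c‖²` is of the order of
the penalty parameter. -/
theorem norm_act_Jc_transpose_le {B : ℝ}
    (hJ : ∀ j, ‖(D.run u j).Jr‖ ≤ B ∧ ‖(D.run u j).Jc‖ ≤ B)
    (hf : ∀ j, ‖D.r (D.run u j).x‖ ≤ B ∧ ‖D.c (D.run u j).x‖ ≤ B)
    {j : ℕ} (hδ : 0 < (D.run u j).δ) (hne : (D.run u (j + 1)).δ ≠ (D.run u j).δ) :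
    ‖act (D.run u (j + 1)).Jcᵀ (D.c (D.run u (j + 1)).x)‖ ≤
      (D.θ * ‖D.gradL D.Jrk D.Jck D.xk D.yk‖ + 1 / 2 * D.εk + B * B + B * ‖D.yk‖)
        * (D.run u j).δ := by
  have hB : 0 ≤ B := (norm_nonneg _).trans (hJ 0).1
  obtain ⟨-, hle⟩ := (D.δ_succ_eq_or hnt j).resolve_left hne
  set s := D.run u (j + 1)
  set δ := (D.run u j).δ
  have h1 : ‖act s.Jrᵀ (D.r s.x)‖ ≤ B * B := by
    refine (norm_act_le _ _).trans ?_
    rw [norm_transpose_eq]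
    exact mul_le_mul (hJ _).1 (hf _).1 (norm_nonneg _) hB
  have h2 : ‖act s.Jcᵀ D.yk‖ ≤ B * ‖D.yk‖ := by
    refine (norm_act_le _ _).trans ?_
    rw [norm_transpose_eq]
    exact mul_le_mul_of_nonneg_right (hJ _).2 (norm_nonneg _)
  have h3 : δ⁻¹ • act s.Jcᵀ (D.c s.x)
      = D.gradPhi s.Jr s.Jc s.x δ - act s.Jrᵀ (D.r s.x) + act s.Jcᵀ D.yk := by
    rw [gradPhi]; abel
  have h4 : ‖δ⁻¹ • act s.Jcᵀ (D.c s.x)‖ ≤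
      D.θ * ‖D.gradL D.Jrk D.Jck D.xk D.yk‖ + 1 / 2 * D.εk + B * B + B * ‖D.yk‖ := by
    rw [h3]
    refine (norm_add_le _ _).trans (add_le_add ((norm_sub_le _ _).trans ?_) h2)
    exact add_le_add hle h1
  rw [norm_smul, norm_inv, Real.norm_of_nonneg hδ.le, inv_mul_le_iff₀ hδ] at h4
  linarith

theorem tendsto_γ_of_finite (hfin : ∀ᶠ j in atTop, (D.run u (j + 1)).δ = (D.run u j).δ) :
    Tendsto (fun j => (D.run u j).γ) atTop (nhds 0) := by
  refine tendsto_zero_of_eventually_halved (fun j => (D.γ_pos hD hnt j).le)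
    (D.γ_succ_le_two_mul hD hnt) fun η _ => ?_
  obtain ⟨N, hN⟩ := eventually_atTop.1 hfin
  refine eventually_atTop.2 ⟨N + 1, fun j hj _ => ?_⟩
  obtain ⟨i, rfl⟩ := Nat.exists_eq_succ_of_ne_zero (by omega : j ≠ 0)
  exact D.γ_succ_le_half hnt (hN i (by simp only [Nat.succ_eq_add_one] at hj; omega))

/-- If `δ` was kept, `γ` is halved outright. If it dropped, `‖(J^c_s)ᵀ c‖ = O(δ)` eventually lies
below `p₃γ` whenever `γ ≥ η`, which selects the halving branch. -/
theorem tendsto_γ_of_infinite {B : ℝ}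
    (hJ : ∀ j, ‖(D.run u j).Jr‖ ≤ B ∧ ‖(D.run u j).Jc‖ ≤ B)
    (hf : ∀ j, ‖D.r (D.run u j).x‖ ≤ B ∧ ‖D.c (D.run u j).x‖ ≤ B)
    (hinf : {j | (D.run u (j + 1)).δ < (D.run u j).δ}.Infinite) :
    Tendsto (fun j => (D.run u j).γ) atTop (nhds 0) := by
  refine tendsto_zero_of_eventually_halved (fun j => (D.γ_pos hD hnt j).le)
    (D.γ_succ_le_two_mul hD hnt) fun η hη => ?_
  have hlim := (D.tendsto_δ hD hnt hinf).const_mul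
    (D.θ * ‖D.gradL D.Jrk D.Jck D.xk D.yk‖ + 1 / 2 * D.εk + B * B + B * ‖D.yk‖)
  rw [mul_zero] at hlim
  obtain ⟨N, hN⟩ := eventually_atTop.1
    (hlim.eventually (gt_mem_nhds (mul_pos hD.p3_pos hη)))
  refine eventually_atTop.2 ⟨N + 1, fun j hj hηj => ?_⟩
  obtain ⟨i, rfl⟩ := Nat.exists_eq_succ_of_ne_zero (by omega : j ≠ 0)
  rw [Nat.succ_eq_add_one] at hj hηj ⊢
  by_cases hδ : (D.run u (i + 1)).δ = (D.run u i).δ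
  · exact D.γ_succ_le_half hnt hδ
  · have hprev : (D.run u (i + 1)).δprev = (D.run u i).δ := by rw [D.run_succ hnt]; rfl
    have hsmall := D.norm_act_Jc_transpose_le hnt hJ hf (D.δ_pos u hD i) hδ
    have hlt := hN i (by omega)
    have hp := mul_le_mul_of_nonneg_left hηj hD.p3_pos.le
    rw [D.run_succ hnt (i + 1)]
    change D.nextγ _ ≤ _
    unfold nextγ
    rw [if_neg (by rwa [hprev]), if_pos (by linarith)]

theorem liminf_eq_zero_of_infinite (hr : ContDiff ℝ 1 D.r) (hc : ContDiff ℝ 1 D.c)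
    {κ : ℝ} (hκ : 0 ≤ κ)
    (hljr : ∀ x y, ‖jac D.r x - jac D.r y‖ ≤ κ * ‖x - y‖)
    (hljc : ∀ x y, ‖jac D.c x - jac D.c y‖ ≤ κ * ‖x - y‖) {B : ℝ}
    (hJ : ∀ j, ‖(D.run u j).Jr‖ ≤ B ∧ ‖(D.run u j).Jc‖ ≤ B)
    (hf : ∀ j, ‖D.r (D.run u j).x‖ ≤ B ∧ ‖D.c (D.run u j).x‖ ≤ B)
    (hinf : {j | (D.run u (j + 1)).δ < (D.run u j).δ}.Infinite) :
    liminf (fun j => ‖act (jac D.c (D.run u j).x)ᵀ (D.c (D.run u j).x)‖ₑ) atTop = 0 := by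
  set K := D.θ * ‖D.gradL D.Jrk D.Jck D.xk D.yk‖ + 1 / 2 * D.εk + B * B + B * ‖D.yk‖ with hK
  have hlim : Tendsto (fun j => K * (D.run u j).δ + n * κ * (D.run u (j + 1)).γ * B) atTop
      (nhds (K * 0 + n * κ * 0 * B)) :=
    ((D.tendsto_δ hD hnt hinf).const_mul K).add
      ((((D.tendsto_γ_of_infinite hD hnt hJ hf hinf).comp (tendsto_add_atTop_nat 1)).const_mul
        (n * κ)).mul_const B)
  have hz : K * 0 + n * κ * 0 * B = 0 := by ring
  rw [hz] at hlim
  have hbound : ∀ j, (D.run u (j + 1)).δ < (D.run u j).δ →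
      ‖act (jac D.c (D.run u (j + 1)).x)ᵀ (D.c (D.run u (j + 1)).x)‖
        ≤ K * (D.run u j).δ + n * κ * (D.run u (j + 1)).γ * B := by
    intro j hj
    have h1 := D.norm_act_Jc_transpose_le hnt hJ hf (D.δ_pos u hD j) hj.ne
    have h2 := (D.norm_jacobian_error_le hD hnt hr hc hκ hljr hljc (j + 1)).2
    have hγ := D.γ_pos hD hnt (j + 1)
    set s := D.run u (j + 1)
    have h3 : ‖act (s.Jc - jac D.c s.x)ᵀ (D.c s.x)‖ ≤ n * κ * s.γ * B := by
      refine (norm_act_le _ _).trans ?_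
      rw [norm_transpose_eq]
      exact mul_le_mul h2 (hf _).2 (norm_nonneg _) (by positivity)
    have h4 : act (jac D.c s.x)ᵀ (D.c s.x)
        = act s.Jcᵀ (D.c s.x) - act (s.Jc - jac D.c s.x)ᵀ (D.c s.x) := by
      rw [Matrix.transpose_sub, sub_act]; abel
    rw [h4]
    exact (norm_sub_le _ _).trans (add_le_add h1 h3)
  refine le_antisymm (ENNReal.le_of_forall_pos_le_add fun ε hε _ => ?_) zero_le
  rw [zero_add]
  refine liminf_le_of_frequently_le' ?_
  have hfr := (Nat.frequently_atTop_iff_infinite.2 hinf).and_eventually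
    (hlim.eventually (gt_mem_nhds (NNReal.coe_pos.2 hε)))
  -- The estimate concerns the point reached by the drop, hence the index shift.
  refine (tendsto_add_atTop_nat 1).frequently (hfr.mono fun j hj => ?_)
  rw [← ofReal_norm]
  exact ENNReal.ofReal_le_of_le_toReal ((hbound j hj.1).trans hj.2.le)

/-- If the penalty parameter is eventually constant, the inner procedure terminates: otherwise the
Levenberg–Marquardt iteration with a gradient bounded away from zero would decrease `‖Φ_k‖²`
by a fixed amount infinitely often. -/
theorem false_of_eventually_const (hr : ContDiff ℝ 1 D.r) (hc : ContDiff ℝ 1 D.c)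
    {κ : ℝ} (hκ : 0 ≤ κ)
    (hljr : ∀ x y, ‖jac D.r x - jac D.r y‖ ≤ κ * ‖x - y‖)
    (hljc : ∀ x y, ‖jac D.c x - jac D.c y‖ ≤ κ * ‖x - y‖) {B : ℝ}
    (hJ : ∀ j, ‖(D.run u j).Jr‖ ≤ B ∧ ‖(D.run u j).Jc‖ ≤ B)
    (hf : ∀ j, ‖D.r (D.run u j).x‖ ≤ B ∧ ‖D.c (D.run u j).x‖ ≤ B)
    (hfin : ∀ᶠ j in atTop, (D.run u (j + 1)).δ = (D.run u j).δ) : False := by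
  have hB : 0 ≤ B := (norm_nonneg _).trans (hJ 0).1
  have hp0 := hD.p0_pos
  have hp01 : D.p0 < 1 := hD.p0_lt.trans hD.p1_lt
  obtain ⟨N, hN⟩ := eventually_atTop.1 hfin
  obtain ⟨δ, hδ⟩ : ∃ δ, δ = (D.run u N).δ := ⟨_, rfl⟩
  have hδpos : 0 < δ := hδ ▸ D.δ_pos u hD N
  have hδj : ∀ j, N ≤ j → (D.run u j).δ = δ := by
    intro j hj
    induction j, hj using Nat.le_induction with
    | base => exact hδ.symm
    | succ j hj ih => rw [hN j hj, ih]
  obtain ⟨σ, hσ⟩ : ∃ σ, σ = (Real.sqrt δ)⁻¹ := ⟨_, rfl⟩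
  have hσ0 : 0 ≤ σ := by rw [hσ]; positivity
  obtain ⟨b, hb⟩ : ∃ b, b = B + σ * B := ⟨_, rfl⟩
  have hb0 : 0 ≤ b := by rw [hb]; positivity
  obtain ⟨F, hF⟩ : ∃ F, F = B + σ * (B + δ * ‖D.yk‖) := ⟨_, rfl⟩
  have hF0 : 0 ≤ F := by rw [hF]; positivity
  obtain ⟨ε, hε⟩ : ∃ ε, ε = 1 / 2 * D.εk := ⟨_, rfl⟩
  have hε0 : 0 < ε := by rw [hε]; have := hD.εk_pos; positivity
  have hJb : ∀ j, N ≤ j → ‖(D.run u j).JPhi‖ ≤ b := by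
    intro j hj
    have := (D.run u j).norm_JPhi_le (hJ j).1 (hJ j).2
    rwa [hδj j hj, ← hσ, ← hb] at this
  have hΦF : ∀ j, N ≤ j → ‖D.bigPhi (D.run u j).x (D.run u j).δ‖ ≤ F := by
    intro j hj
    have := D.norm_bigPhi_le (hf j).1 (hf j).2 hδpos.le
    rwa [← hσ, ← hF, ← hδj j hj] at this
  have hgε : ∀ j, N + 1 ≤ j → ε ≤ ‖D.grad (D.run u j)‖ := by
    intro j hj
    obtain ⟨i, rfl⟩ := Nat.exists_eq_add_of_le' (show 1 ≤ j by omega)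
    exact hε ▸ (D.half_εk_lt_norm_grad hD hnt (hN i (by omega))).le
  have hgG : ∀ j, N ≤ j → ‖D.grad (D.run u j)‖ ≤ b * F := by
    intro j hj
    rw [← D.act_JPhi_transpose_bigPhi _ (D.δ_pos u hD j)]
    refine (norm_act_le _ _).trans ?_
    rw [norm_transpose_eq]
    exact mul_le_mul (hJb j hj) (hΦF j hj) (norm_nonneg _) hb0
  -- The model accuracy that `le_ratio_of_large_lam` needs for `ρ = p₀`; one half is granted to `γ`,
  -- the other to `1/λ`.
  obtain ⟨η, hη⟩ : ∃ η, η = min 1 ((1 - D.p0) * ε / (2 * F + 1)) := ⟨_, rfl⟩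
  have hη0 : 0 < η := by
    rw [hη]
    exact lt_min one_pos (div_pos (mul_pos (by linarith) hε0) (by positivity))
  have hη1 : η ≤ 1 := hη ▸ min_le_left _ _
  have hη2 : (2 * F + 1) * η ≤ (1 - D.p0) * ε := by
    rw [mul_comm, ← le_div_iff₀ (by positivity)]
    exact hη ▸ min_le_right _ _
  obtain ⟨N', hN'⟩ : ∃ N', ∀ j, N' ≤ j → (1 + σ) * (n * κ) * (D.run u j).γ < η / 2 := by
    have hlim := (D.tendsto_γ_of_finite hD hnt hfin).const_mul ((1 + σ) * (n * κ))
    rw [mul_zero] at hlim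
    exact eventually_atTop.1 (hlim.eventually (gt_mem_nhds (half_pos hη0)))
  obtain ⟨N₁, hN₁⟩ : ∃ N₁, N₁ = max (N + 1) N' := ⟨_, rfl⟩
  have hN₁N : N + 1 ≤ N₁ := hN₁ ▸ le_max_left _ _
  have hN₁N' : N' ≤ N₁ := hN₁ ▸ le_max_right _ _
  -- Beyond `Λ`: steps have length at most 1, the `κ/λ` error fits in `η/2`, `‖J‖² ≤ λε`, and `λ‖g‖
  -- ≥ p₂`.
  obtain ⟨Λ, hΛ1, hΛ2, hΛ3, hΛ4⟩ : ∃ Λ, 1 ≤ Λ ∧ (1 + σ) * κ / (η / 2) ≤ Λ ∧ b ^ 2 / ε ≤ Λ ∧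
      D.p2 / ε ≤ Λ :=
    ⟨max (max 1 ((1 + σ) * κ / (η / 2))) (max (b ^ 2 / ε) (D.p2 / ε)), by simp, by simp, by simp,
      by simp⟩
  rw [div_le_iff₀ (by positivity)] at hΛ2 hΛ3 hΛ4
  have hlampos : ∀ j, 0 < (D.run u j).lam :=
    fun j => hD.lamMin_pos.trans_le (D.lamMin_le_lam u hD j)
  have hacc : ∀ j, N₁ ≤ j → Λ ≤ (D.run u j).lam → D.p0 ≤ D.ratio (D.run u j) := by
    intro j hj hlam
    obtain ⟨hsr, hsc⟩ := D.norm_jacobian_error_le hD hnt hr hc hκ hljr hljc j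
    refine D.le_ratio_of_large_lam hr hc hκ hljr hljc hsr hsc (D.δ_pos u hD j)
      (hΦF j (by omega)) hε0 (hgε j (by omega)) hp01.le hη1 hη2 (hΛ1.trans hlam) ?_ ?_
    · refine (pow_le_pow_left₀ (norm_nonneg _) (hJb j (by omega)) 2).trans (hΛ3.trans ?_)
      gcongr
    · have h1 : (1 + σ) * κ * (D.run u j).lam⁻¹ ≤ η / 2 := by
        rw [← div_eq_mul_inv, div_le_iff₀ (hlampos j), mul_comm (η / 2)]
        refine hΛ2.trans ?_
        gcongr
      rw [hδj j (by omega), ← hσ]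
      linarith [hN' j (by omega)]
  obtain ⟨M, hM⟩ : ∃ M, M = max (D.run u N₁).lam (4 * Λ) := ⟨_, rfl⟩
  -- Above `Λ` the parameter does not grow; below `Λ` it at most quadruples.
  have hlamM : ∀ j, N₁ ≤ j → (D.run u j).lam ≤ M := by
    intro j hj
    induction j, hj using Nat.le_induction with
    | base => exact hM ▸ le_max_left _ _
    | succ j hj ih =>
      rw [D.run_succ hnt]
      change D.nextLam _ ≤ M
      rcases le_or_gt Λ (D.run u j).lam with h | h
      · refine (D.nextLam_le_self hD.lamMin_pos (D.lamMin_le_lam u hD j) (D.δ_pos u hD j)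
          (hD.p1_lt.trans hD.p2_gt).le (hacc j hj h) (hΛ4.trans ?_)).trans ih
        exact mul_le_mul h (hgε j (by omega)) hε0.le (hlampos j).le
      · refine (D.nextLam_le hD.lamMin_pos (D.lamMin_le_lam u hD j)).trans ?_
        rw [hM]
        exact le_max_of_le_right (by linarith)
  obtain ⟨c, hc'⟩ : ∃ c, c = 2 * (D.lamMin * ε * (ε / (b ^ 2 + M * (b * F))) ^ 2) := ⟨_, rfl⟩
  have hc0 : 0 < c := by
    have h1 : 0 < b * F := hε0.trans_le ((hgε N₁ hN₁N).trans (hgG N₁ (by omega)))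
    have h2 : 0 < M := (hlampos N₁).trans_le (hlamM N₁ le_rfl)
    have h3 := hD.lamMin_pos
    rw [hc']
    positivity
  have hpred : ∀ j, N₁ ≤ j → c ≤ ‖D.bigPhi (D.run u j).x δ‖ ^ 2
      - ‖D.bigPhi (D.run u j).x δ + act (D.run u j).JPhi (D.lmStep (D.run u j))‖ ^ 2 := by
    intro j hj
    have := D.le_predicted_reduction (D.δ_pos u hD j) hε0 (hgε j (by omega)) (hgG j (by omega))
      hD.lamMin_pos (D.lamMin_le_lam u hD j) (hlamM j hj) (hJb j (by omega))
    rwa [hδj j (by omega), ← hc'] at this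
  have hx : ∀ j, (D.run u (j + 1)).x = D.nextX (D.run u j) := fun j => by
    rw [D.run_succ hnt]; rfl
  have hdec : ∀ j, N₁ ≤ j → D.p0 ≤ D.ratio (D.run u j) →
      D.p0 * c ≤ ‖D.bigPhi (D.run u j).x δ‖ ^ 2 - ‖D.bigPhi (D.run u (j + 1)).x δ‖ ^ 2 := by
    intro j hj hρ
    have hg0 : D.grad (D.run u j) ≠ 0 := norm_pos_iff.1 (hε0.trans_le (hgε j (by omega)))
    rw [hx, nextX, if_pos hρ]
    rw [D.le_ratio_iff _ (hlampos j) hg0 (D.δ_pos u hD j), hδj j (by omega)] at hρ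
    exact (mul_le_mul_of_nonneg_left (hpred j hj) hp0.le).trans hρ
  have hanti : Antitone fun k => ‖D.bigPhi (D.run u (N₁ + k)).x δ‖ ^ 2 := by
    refine antitone_nat_of_succ_le fun k => ?_
    by_cases hρ : D.p0 ≤ D.ratio (D.run u (N₁ + k))
    · have := hdec (N₁ + k) (by omega) hρ
      have := mul_pos hp0 hc0
      rw [← add_assoc]
      linarith
    · rw [← add_assoc, hx, nextX, if_neg hρ]
  -- The values `‖Φ_k‖²` decrease to a limit, so drops of size `p₀c` must stop.
  have hrej : ∀ᶠ k in atTop, D.ratio (D.run u (N₁ + k)) < D.p0 := by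
    have hbdd : BddBelow (Set.range fun k => ‖D.bigPhi (D.run u (N₁ + k)).x δ‖ ^ 2) :=
      ⟨0, by rintro _ ⟨k, rfl⟩; positivity⟩
    filter_upwards [eventually_sub_succ_lt (tendsto_atTop_ciInf hanti hbdd) (mul_pos hp0 hc0)]
      with k hk
    by_contra! hρ
    exact absurd (hdec (N₁ + k) (by omega) hρ) (not_le.2 hk)
  obtain ⟨k₀, hk₀⟩ := eventually_atTop.1 hrej
  have hgrow : ∀ i, (D.run u (N₁ + k₀ + i)).lam = 4 ^ i * (D.run u (N₁ + k₀)).lam := by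
    intro i
    induction i with
    | zero => simp
    | succ i ih =>
      have hlam : (D.run u (N₁ + k₀ + (i + 1))).lam = D.nextLam (D.run u (N₁ + k₀ + i)) := by
        rw [← add_assoc, D.run_succ hnt]; rfl
      have hρ := hk₀ (k₀ + i) (by omega)
      rw [← add_assoc] at hρ
      rw [hlam, nextLam, if_pos hρ, ih, pow_succ]
      ring
  obtain ⟨i, hi⟩ := pow_unbounded_of_one_lt (M / (D.run u (N₁ + k₀)).lam)
    (show (1 : ℝ) < 4 by norm_num)
  rw [div_lt_iff₀ (hlampos _), ← hgrow] at hi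
  exact absurd (hlamM _ (by omega)) (not_le.2 hi)

end NonTerminating

end Input

end DFLM


/-! ### From single paths to probabilities -/

theorem theorem3p1 {n p m : ℕ} (D : DFLM.Input n p m) (hD : D.Valid)
    -- `r` and `c` are continuously differentiable, with Lipschitz Jacobians, and Lipschitz
    (hr : ContDiff ℝ 1 D.r) (hc : ContDiff ℝ 1 D.c)
    (hljr : ∃ κ : ℝ, 0 < κ ∧ ∀ x y, ‖DFLM.jac D.r x - DFLM.jac D.r y‖ ≤ κ * ‖x - y‖)
    (hljc : ∃ κ : ℝ, 0 < κ ∧ ∀ x y, ‖DFLM.jac D.c x - DFLM.jac D.c y‖ ≤ κ * ‖x - y‖)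
    (hlr : ∃ κ : ℝ, 0 < κ ∧ ∀ x y, ‖D.r x - D.r y‖ ≤ κ * ‖x - y‖)
    (hlc : ∃ κ : ℝ, 0 < κ ∧ ∀ x y, ‖D.c x - D.c y‖ ≤ κ * ‖x - y‖)
    -- independent uniform samples from the Stiefel manifold
    {Ω : Type*} [MeasurableSpace Ω] (P : Measure Ω) [IsProbabilityMeasure P]
    (U : ℕ → Ω → DFLM.St n) (hU : ∀ j, DFLM.IsUniformStiefel P (U j)) (hind : iIndepFun U P)
    -- in every realization, approximate Jacobians and function values are bounded
    (hJ : ∀ ω, ∃ B : ℝ, ∀ j, ‖(D.run (fun i => U i ω) j).Jr‖ ≤ B ∧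
      ‖(D.run (fun i => U i ω) j).Jc‖ ≤ B)
    (hf : ∀ ω, ∃ B : ℝ, ∀ j, ‖D.r (D.run (fun i => U i ω) j).x‖ ≤ B ∧
      ‖D.c (D.run (fun i => U i ω) j).x‖ ≤ B) :
    (P (D.finiteDecrease U) ≠ 0 → ∀ q : ℝ, 0 < q → q < 1 →
      ∃ j : ℕ, ENNReal.ofReal q
        ≤ P[{ω | D.SufficientDecrease (D.run (fun i => U i ω) (j + 1))} | D.finiteDecrease U]) ∧
    (∀ᵐ ω ∂P, ω ∈ (D.finiteDecrease U)ᶜ →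
      liminf (fun j : ℕ => ‖DFLM.act (DFLM.jac D.c (D.run (fun i => U i ω) j).x)ᵀ
        (D.c (D.run (fun i => U i ω) j).x)‖ₑ) atTop = 0) := by
  obtain ⟨κr, hκr, hlr'⟩ := hljr
  obtain ⟨κc, hκc, hlc'⟩ := hljc
  obtain ⟨κ, hκ, hr', hc'⟩ : ∃ κ : ℝ, 0 ≤ κ ∧
      (∀ x y, ‖DFLM.jac D.r x - DFLM.jac D.r y‖ ≤ κ * ‖x - y‖) ∧
      (∀ x y, ‖DFLM.jac D.c x - DFLM.jac D.c y‖ ≤ κ * ‖x - y‖) :=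
    ⟨max κr κc, hκr.le.trans (le_max_left _ _),
      fun x y => (hlr' x y).trans
        (mul_le_mul_of_nonneg_right (le_max_left _ _) (norm_nonneg _)),
      fun x y => (hlc' x y).trans
        (mul_le_mul_of_nonneg_right (le_max_right _ _) (norm_nonneg _))⟩
  have hB : ∀ ω, ∃ B : ℝ, (∀ j, ‖(D.run (fun i => U i ω) j).Jr‖ ≤ B ∧
      ‖(D.run (fun i => U i ω) j).Jc‖ ≤ B) ∧
      ∀ j, ‖D.r (D.run (fun i => U i ω) j).x‖ ≤ B ∧ ‖D.c (D.run (fun i => U i ω) j).x‖ ≤ B := by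
    intro ω
    obtain ⟨B₁, h₁⟩ := hJ ω
    obtain ⟨B₂, h₂⟩ := hf ω
    exact ⟨max B₁ B₂,
      fun j => ⟨le_max_of_le_left (h₁ j).1, le_max_of_le_left (h₁ j).2⟩,
      fun j => ⟨le_max_of_le_right (h₂ j).1, le_max_of_le_right (h₂ j).2⟩⟩
  constructor
  · intro hE q _ hq1
    have hmono : Monotone fun j : ℕ =>
        {ω | D.SufficientDecrease (D.run (fun i => U i ω) (j + 1))} := by
      refine monotone_nat_of_le_succ fun j ω hω => ?_
      have h := D.run_succ_of_sufficientDecrease _ hω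
      change D.SufficientDecrease (D.run _ (j + 2))
      rw [h]
      exact hω
    have hcover : D.finiteDecrease U ⊆
        ⋃ j : ℕ, {ω | D.SufficientDecrease (D.run (fun i => U i ω) (j + 1))} := by
      intro ω hω
      by_contra hcon
      have hnt : ∀ j, ¬ D.SufficientDecrease (D.run (fun i => U i ω) (j + 1)) := by
        simpa using hcon
      obtain ⟨B, hJB, hfB⟩ := hB ω
      refine D.false_of_eventually_const hD hnt hr hc hκ hr' hc' hJB hfB ?_
      obtain ⟨N, hN⟩ := Set.Finite.bddAbove hω
      refine eventually_atTop.2 ⟨N + 1, fun j hj => ?_⟩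
      refine le_antisymm (D.δ_antitone hD hnt (Nat.le_succ j)) (not_lt.1 fun hlt => ?_)
      exact absurd (hN hlt) (by omega)
    -- The union contains the conditioning event, so no measurability is needed here; nor is it for
    -- the increasing union below.
    have hone : P[⋃ j : ℕ, {ω | D.SufficientDecrease (D.run (fun i => U i ω) (j + 1))}
        | D.finiteDecrease U] = 1 := by
      rw [ProbabilityTheory.cond, Measure.smul_apply, Measure.restrict_apply_superset hcover,
        smul_eq_mul, ENNReal.inv_mul_cancel hE (measure_ne_top _ _)]
    rw [hmono.measure_iUnion] at hone
    have hlt : ENNReal.ofReal q < ⨆ j : ℕ,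
        P[{ω | D.SufficientDecrease (D.run (fun i => U i ω) (j + 1))} | D.finiteDecrease U] := by
      rw [hone]
      exact ENNReal.ofReal_lt_one.2 hq1
    obtain ⟨j, hj⟩ := lt_iSup_iff.1 hlt
    exact ⟨j, hj.le⟩
  · refine Eventually.of_forall fun ω hω => ?_
    have hinf : {j : ℕ | (D.run (fun i => U i ω) (j + 1)).δ
        < (D.run (fun i => U i ω) j).δ}.Infinite := hω
    -- A return freezes the state, leaving only finitely many drops of `δ`.
    have hnt : ∀ j, ¬ D.SufficientDecrease (D.run (fun i => U i ω) (j + 1)) := by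
      intro j hj
      have hconst : ∀ i, j + 1 ≤ i → D.run (fun i => U i ω) i = D.run (fun i => U i ω) (j + 1) := by
        intro i hi
        induction i, hi using Nat.le_induction with
        | base => rfl
        | succ i hi ih =>
          obtain ⟨l, rfl⟩ := Nat.exists_eq_add_of_le' (show 1 ≤ i by omega)
          rw [D.run_succ_of_sufficientDecrease _ (by rw [ih]; exact hj), ih]
      refine hinf ((Set.finite_Iio (j + 1)).subset fun i hi => ?_)
      by_contra hcon
      have hle : j + 1 ≤ i := not_lt.1 hcon
      have hi' : (D.run (fun i => U i ω) (i + 1)).δ < (D.run (fun i => U i ω) i).δ := hi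
      rw [hconst i hle, hconst (i + 1) (by omega)] at hi'
      exact lt_irrefl _ hi'
    obtain ⟨B, hJB, hfB⟩ := hB ω
    exact D.liminf_eq_zero_of_infinite hD hnt hr hc hκ hr' hc' hJB hfB hinf
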